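/- Let $M_3$ be the space of real $3\times 3$ matrices, let $A\in M_3$, and let $\mathcal{K}_3=\{(\xi,\eta):\ \xi\in\mathbb{R}^2,\ \eta\in\mathbb{R},\ \|\xi\|_2\le \eta\}\subset\mathbb{R}^3$ be the Lorentz cone. A real number $\lambda$ is a Lorentz eigenvalue of $A$, with associated Lorentz eigenvector $x\in\mathbb{R}^3$, if $x\neq 0$, $x\in\mathcal{K}_3$, $(A-\lambda I)x\in\mathcal{K}_3$ and $x^T(A-\lambda I)x=0$. The Lorentz spectrum $\sigma_L(A)$ is the set of all Lorentz eigenvalues of $A$; the interior Lorentz spectrum $\sigma_{int}(A)$ (resp. the boundary Lorentz spectrum $\sigma_{bd}(A)$) is the set of those $\lambda$ that have an associated Lorentz eigenvector in the interior (resp. on the boundary) of $\mathcal{K}_3$. Theorem. Let $\phi:M_3\to M_3$ be a linear map such that $\sigma_L(A)=\sigma_L(\phi(A))$ for all $A\in M_3$. Then for all $A\in M_3$, $$\sigma_{int}(A)=\sigma_{int}(\phi(A))\quad\text{and}\quad \sigma_{bd}(A)=\sigma_{bd}(\phi(A)).$$ -/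

import Mathlib

open scoped Matrix

/-- The Lorentz cone in `ℝ^(m+1)`: all vectors `x = (ξ, η)` with `ξ ∈ ℝ^m`, `η ∈ ℝ` and
`‖ξ‖₂ ≤ η`. Here `ξ` consists of the first `m` coordinates of `x` and `η` is the last one. -/
def lorentzCone (m : ℕ) : Set (Fin (m + 1) → ℝ) :=
  {x | ‖WithLp.toLp 2 (Fin.init x : Fin m → ℝ)‖ ≤ x (Fin.last m)}

/-- `x` is a Lorentz eigenvector of `A` associated with `lam`: `x` is nonzero, `x` and
`(A - lam I) x` lie in the (self-dual) Lorentz cone, and `xᵀ (A - lam I) x = 0`. -/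
def IsLorentzEigenvector {m : ℕ} (A : Matrix (Fin (m + 1)) (Fin (m + 1)) ℝ) (lam : ℝ)
    (x : Fin (m + 1) → ℝ) : Prop :=
  x ≠ 0 ∧ x ∈ lorentzCone m ∧
    (A - lam • (1 : Matrix (Fin (m + 1)) (Fin (m + 1)) ℝ)) *ᵥ x ∈ lorentzCone m ∧
    x ⬝ᵥ ((A - lam • (1 : Matrix (Fin (m + 1)) (Fin (m + 1)) ℝ)) *ᵥ x) = 0

/-- The Lorentz spectrum of `A`. -/
def lorentzSpectrum {m : ℕ} (A : Matrix (Fin (m + 1)) (Fin (m + 1)) ℝ) : Set ℝ :=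
  {lam | ∃ x, IsLorentzEigenvector A lam x}

/-- The interior Lorentz spectrum: Lorentz eigenvalues having an associated Lorentz eigenvector
in the topological interior of the Lorentz cone. -/
def interiorLorentzSpectrum {m : ℕ} (A : Matrix (Fin (m + 1)) (Fin (m + 1)) ℝ) : Set ℝ :=
  {lam | ∃ x, IsLorentzEigenvector A lam x ∧ x ∈ interior (lorentzCone m)}

/-- The boundary Lorentz spectrum: Lorentz eigenvalues having an associated Lorentz eigenvector
on the topological boundary of the Lorentz cone. -/
def boundaryLorentzSpectrum {m : ℕ} (A : Matrix (Fin (m + 1)) (Fin (m + 1)) ℝ) : Set ℝ :=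
  {lam | ∃ x, IsLorentzEigenvector A lam x ∧ x ∈ frontier (lorentzCone m)}

/-- A linear map on square matrices that is a linear preserver of the Lorentz spectrum. -/
def IsLorentzSpectrumPreserver {m : ℕ}
    (φ : Matrix (Fin (m + 1)) (Fin (m + 1)) ℝ →ₗ[ℝ] Matrix (Fin (m + 1)) (Fin (m + 1)) ℝ) :
    Prop :=
  ∀ A, lorentzSpectrum A = lorentzSpectrum (φ A)

/-!
A linear preserver `φ` of the Lorentz spectrum on `3 × 3` matrices is shown to be a conjugation
`A ↦ P A Pᵀ`, where `P` is an orthogonal matrix that fixes the axis of the cone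
(`exists_isAxialIsometry_map_eq`). Such a `P` is a homeomorphism of the cone, so it carries interior
eigenvectors to interior eigenvectors and boundary ones to boundary ones, for the same eigenvalue.

Rescale a Lorentz eigenvector to `x = (c, s, 1)`. If `c² + s² < 1`, complementarity forces
`A x = lam x`. If `c² + s² = 1`, it says that `A x` has no component along the tangent `(-s, c, 0)`,
that `2 lam = xᵀ A x`, and that `lam ≤ (A x)₂` (`mem_lorentzSpectrum_two_iff`). Write
`tangentialForm A c s` and `rayForm A c s` for the two trigonometric polynomials involved. Both are
linear in `A`.

* The spectrum of `A` is finite unless `tangentialForm A` vanishes on the whole circle, that is,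
  unless `A = arrow a v w d` has upper blocks `a I` and `0`. The spectrum of such a matrix is
  explicit, and when it consists of a nondegenerate interval and a point below it, it determines
  `a`, `d` and `v² + w²`. Hence `φ` maps arrow matrices to arrow matrices, keeps `a` and `d`, and
  acts on `(v, w)` by a linear isometry (`map_arrow`). After a conjugation, `φ` fixes all arrow
  matrices.
* Adding `arrow 0 v w d` to `A` does not change the zeros of `tangentialForm A`. If `d` is large,
  all these zeros give Lorentz eigenvalues, and they are recognized by how the eigenvalue varies
  with `(v, w)`. So at each zero of `tangentialForm A`, the form `tangentialForm (φ A)` also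
  vanishes, and `rayForm (φ A) = rayForm A` (`tangentialForm_rayForm_map_of_zero`).
* By linearity, on the circle `tangentialForm (φ A) = h * tangentialForm A` and
  `rayForm (φ A) = rayForm A + k * tangentialForm A`, with `h`, `k` independent of `A`. These
  multipliers are trigonometric polynomials of degree at most two, and so are the products, which
  forces `h = 1` and `k = 0` (`map_forms_eq`). Therefore `φ A = A + α diag(1, 1, -1)`.
* Finally `α = 0` by comparing an interior eigenvalue `0` of `A + arrow (-M) 0 0 0` for large `M`
  (`map_eq_of_interior`).
-/

/-! ### The Lorentz spectrum in dimension three -/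

lemma mem_lorentzCone_two_iff (x : Fin 3 → ℝ) :
    x ∈ lorentzCone 2 ↔ 0 ≤ x 2 ∧ x 0 ^ 2 + x 1 ^ 2 ≤ x 2 ^ 2 := by
  have h : x ∈ lorentzCone 2 ↔ √(x 0 ^ 2 + x 1 ^ 2) ≤ x 2 := by
    simp [lorentzCone, EuclideanSpace.norm_eq, Fin.init]
  rw [h, Real.sqrt_le_iff]

/-- The component of `A x` along the tangent vector `(-s, c, 0)`, for `x = (c, s, 1)`. -/
def tangentialForm (A : Matrix (Fin 3) (Fin 3) ℝ) (c s : ℝ) : ℝ :=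
  c * (A 1 0 * c + A 1 1 * s + A 1 2) - s * (A 0 0 * c + A 0 1 * s + A 0 2)

/-- The quadratic form `xᵀ A x` at `x = (c, s, 1)`. -/
def rayForm (A : Matrix (Fin 3) (Fin 3) ℝ) (c s : ℝ) : ℝ :=
  c * (A 0 0 * c + A 0 1 * s + A 0 2) + s * (A 1 0 * c + A 1 1 * s + A 1 2)
    + (A 2 0 * c + A 2 1 * s + A 2 2)

/-- Two orthogonal vectors `(c, s, 1)` and `(p, q, m)` of the Lorentz cone: if the first is interior,
the second is zero; otherwise `(p, q)` is parallel to `(c, s)`. -/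
lemma complementarity_dichotomy {c s p q m : ℝ} (hcs : c ^ 2 + s ^ 2 ≤ 1)
    (hpq : p ^ 2 + q ^ 2 ≤ m ^ 2) (hm : c * p + s * q + m = 0) :
    (c ^ 2 + s ^ 2 < 1 ∧ p = 0 ∧ q = 0 ∧ m = 0) ∨ (c ^ 2 + s ^ 2 = 1 ∧ c * q - s * p = 0) := by
  -- Lagrange's identity for `m = -(c * p + s * q)`
  have key : (1 - c ^ 2 - s ^ 2) * m ^ 2 + (c * q - s * p) ^ 2 ≤ 0 := by
    have hm' : m ^ 2 = (c * p + s * q) ^ 2 := by rw [eq_neg_of_add_eq_zero_right hm]; ring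
    have := mul_nonneg (add_nonneg (sq_nonneg c) (sq_nonneg s)) (sub_nonneg.2 hpq)
    linarith
  have h1 : 0 ≤ (1 - c ^ 2 - s ^ 2) * m ^ 2 := mul_nonneg (by linarith) (sq_nonneg m)
  rcases hcs.lt_or_eq with h | h
  · left
    have hm0 : m ^ 2 = 0 := by
      have : (1 - c ^ 2 - s ^ 2) * m ^ 2 = 0 := by linarith [sq_nonneg (c * q - s * p)]
      exact (mul_eq_zero.1 this).resolve_left (by linarith)
    rw [hm0] at hpq
    exact ⟨h, pow_eq_zero_iff two_ne_zero |>.1 (by linarith [sq_nonneg p, sq_nonneg q]),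
      pow_eq_zero_iff two_ne_zero |>.1 (by linarith [sq_nonneg p, sq_nonneg q]),
      pow_eq_zero_iff two_ne_zero |>.1 hm0⟩
  · exact Or.inr ⟨h, pow_eq_zero_iff two_ne_zero |>.1 (by linarith [sq_nonneg (c * q - s * p)])⟩

/-- Lorentz eigenvectors normalized to `(c, s, 1)`. The two alternatives correspond to eigenvectors in
the interior and on the boundary of the cone. -/
lemma mem_lorentzSpectrum_two_iff (A : Matrix (Fin 3) (Fin 3) ℝ) (lam : ℝ) :
    lam ∈ lorentzSpectrum (m := 2) A ↔
      (∃ c s : ℝ, c ^ 2 + s ^ 2 < 1 ∧ A 0 0 * c + A 0 1 * s + A 0 2 = lam * c ∧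
        A 1 0 * c + A 1 1 * s + A 1 2 = lam * s ∧ A 2 0 * c + A 2 1 * s + A 2 2 = lam) ∨
      (∃ c s : ℝ, c ^ 2 + s ^ 2 = 1 ∧ tangentialForm A c s = 0 ∧ 2 * lam = rayForm A c s ∧
        lam ≤ A 2 0 * c + A 2 1 * s + A 2 2) := by
  constructor
  · rintro ⟨x, hx0, hxK, hyK, hxy⟩
    change Fin 3 → ℝ at x
    obtain ⟨y, hy⟩ : ∃ y, y = (A - lam • (1 : Matrix (Fin 3) (Fin 3) ℝ)) *ᵥ x := ⟨_, rfl⟩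
    replace hyK : y ∈ lorentzCone 2 := hy ▸ hyK
    replace hxy : x ⬝ᵥ y = 0 := hy ▸ hxy
    rw [mem_lorentzCone_two_iff] at hxK hyK
    obtain ⟨h0, h1⟩ := hxK
    have hpos : 0 < x 2 := by
      rcases h0.lt_or_eq with h | h
      · exact h
      · exfalso
        apply hx0
        have e0 : x 0 = 0 := by nlinarith [sq_nonneg (x 0), sq_nonneg (x 1)]
        have e1 : x 1 = 0 := by nlinarith [sq_nonneg (x 0), sq_nonneg (x 1)]
        ext i
        fin_cases i <;> simp [e0, e1, ← h]
    obtain ⟨c, hc⟩ : ∃ c, x 0 = x 2 * c := ⟨x 0 / x 2, by field_simp⟩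
    obtain ⟨s, hs⟩ : ∃ s, x 1 = x 2 * s := ⟨x 1 / x 2, by field_simp⟩
    have y0 : y 0 = x 2 * (A 0 0 * c + A 0 1 * s + A 0 2 - lam * c) := by
      simp [hy, Matrix.mulVec, dotProduct, Fin.sum_univ_three, Matrix.one_apply, hc, hs]; ring
    have y1 : y 1 = x 2 * (A 1 0 * c + A 1 1 * s + A 1 2 - lam * s) := by
      simp [hy, Matrix.mulVec, dotProduct, Fin.sum_univ_three, Matrix.one_apply, hc, hs]; ring
    have y2 : y 2 = x 2 * (A 2 0 * c + A 2 1 * s + A 2 2 - lam) := by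
      simp [hy, Matrix.mulVec, dotProduct, Fin.sum_univ_three, Matrix.one_apply, hc, hs]; ring
    simp only [dotProduct, Fin.sum_univ_three, hc, hs, y0, y1, y2] at hyK hxy h1
    generalize x 2 = r at *
    obtain ⟨p, hp⟩ : ∃ p, p = A 0 0 * c + A 0 1 * s + A 0 2 - lam * c := ⟨_, rfl⟩
    obtain ⟨q, hq⟩ : ∃ q, q = A 1 0 * c + A 1 1 * s + A 1 2 - lam * s := ⟨_, rfl⟩
    obtain ⟨m, hm⟩ : ∃ m, m = A 2 0 * c + A 2 1 * s + A 2 2 - lam := ⟨_, rfl⟩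
    rw [← hp, ← hq, ← hm] at hyK hxy
    have hr2 : 0 < r ^ 2 := by positivity
    have k1 : c ^ 2 + s ^ 2 ≤ 1 := by
      have : r ^ 2 * (c ^ 2 + s ^ 2) ≤ r ^ 2 * 1 := by linarith
      exact le_of_mul_le_mul_left this hr2
    have k2 : 0 ≤ m := nonneg_of_mul_nonneg_right hyK.1 hpos
    have k3 : p ^ 2 + q ^ 2 ≤ m ^ 2 := by
      have : r ^ 2 * (p ^ 2 + q ^ 2) ≤ r ^ 2 * m ^ 2 := by linarith [hyK.2]
      exact le_of_mul_le_mul_left this hr2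
    have k4 : c * p + s * q + m = 0 := by
      have : r ^ 2 * (c * p + s * q + m) = 0 := by linarith [hxy]
      exact (mul_eq_zero.1 this).resolve_left hr2.ne'
    rcases complementarity_dichotomy k1 k3 k4 with ⟨h, hp0, hq0, hm0⟩ | ⟨h, h'⟩
    · exact Or.inl ⟨c, s, h, by linarith, by linarith, by linarith⟩
    · refine Or.inr ⟨c, s, h, ?_, ?_, by linarith⟩
      · unfold tangentialForm
        rw [hp, hq] at h'
        linarith
      · unfold rayForm
        rw [hp, hq, hm] at k4
        linear_combination -k4 - lam * h
  · rintro (⟨c, s, h, e0, e1, e2⟩ | ⟨c, s, h, e0, e1, e2⟩)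
    · refine ⟨![c, s, 1], ?_, ?_, ?_⟩
      · intro h0; simpa using congrFun h0 2
      · rw [mem_lorentzCone_two_iff]; simp; linarith
      · have : (A - lam • (1 : Matrix (Fin 3) (Fin 3) ℝ)) *ᵥ ![c, s, 1] = 0 := by
          ext i
          fin_cases i <;> simp [Matrix.mulVec, dotProduct, Fin.sum_univ_three, Matrix.one_apply] <;>
            linarith
        rw [this]
        exact ⟨by rw [mem_lorentzCone_two_iff]; simp, by simp⟩
    · refine ⟨![c, s, 1], ?_, ?_, ?_⟩
      · intro h0; simpa using congrFun h0 2
      · rw [mem_lorentzCone_two_iff]; simp; linarith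
      · unfold tangentialForm at e0
        unfold rayForm at e1
        set m := A 2 0 * c + A 2 1 * s + A 2 2 - lam with hm
        have : (A - lam • (1 : Matrix (Fin 3) (Fin 3) ℝ)) *ᵥ ![c, s, 1]
            = ![-(m * c), -(m * s), m] := by
          ext i
          fin_cases i <;> simp [Matrix.mulVec, dotProduct, Fin.sum_univ_three, Matrix.one_apply]
          · linear_combination -s * e0 - c * e1 - (A 0 0 * c + A 0 1 * s + A 0 2) * h + c * hm
          · linear_combination c * e0 - s * e1 - (A 1 0 * c + A 1 1 * s + A 1 2) * h + s * hm
          · linarith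
        rw [this]
        refine ⟨?_, ?_⟩
        · rw [mem_lorentzCone_two_iff]
          simp
          refine ⟨by linarith, le_of_eq ?_⟩
          linear_combination m ^ 2 * h
        · simp [dotProduct, Fin.sum_univ_three]
          linear_combination -m * h

/-! ### Arrow matrices and finiteness of the spectrum -/

/-- The matrix with upper left block `a I`, upper right block `0` and last row `(v, w, d)`. These are
exactly the matrices whose tangential form vanishes on the whole unit circle. -/
def arrow (a v w d : ℝ) : Matrix (Fin 3) (Fin 3) ℝ := !![a, 0, 0; 0, a, 0; v, w, d]

lemma arrow_add (a v w d a' v' w' d' : ℝ) :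
    arrow a v w d + arrow a' v' w' d' = arrow (a + a') (v + v') (w + w') (d + d') := by
  ext i j; fin_cases i <;> fin_cases j <;> simp [arrow]

lemma smul_arrow (t a v w d : ℝ) :
    t • arrow a v w d = arrow (t * a) (t * v) (t * w) (t * d) := by
  ext i j; fin_cases i <;> fin_cases j <;> simp [arrow]

lemma arrow_sub (a v w d a' v' w' d' : ℝ) :
    arrow a v w d - arrow a' v' w' d' = arrow (a - a') (v - v') (w - w') (d - d') := by
  ext i j; fin_cases i <;> fin_cases j <;> simp [arrow]

lemma arrow_inj {a v w d a' v' w' d' : ℝ} (h : arrow a v w d = arrow a' v' w' d') :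
    a = a' ∧ v = v' ∧ w = w' ∧ d = d' :=
  ⟨by simpa [arrow] using congrFun₂ h 0 0, by simpa [arrow] using congrFun₂ h 2 0,
    by simpa [arrow] using congrFun₂ h 2 1, by simpa [arrow] using congrFun₂ h 2 2⟩

lemma exists_unit_inner_eq {v w x : ℝ} (h : x ^ 2 ≤ v ^ 2 + w ^ 2) :
    ∃ c s : ℝ, c ^ 2 + s ^ 2 = 1 ∧ v * c + w * s = x := by
  rcases (add_nonneg (sq_nonneg v) (sq_nonneg w)).eq_or_lt with h0 | h0
  · have hv : v = 0 := pow_eq_zero_iff two_ne_zero |>.1 (by linarith [sq_nonneg v, sq_nonneg w])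
    have hw : w = 0 := pow_eq_zero_iff two_ne_zero |>.1 (by linarith [sq_nonneg v, sq_nonneg w])
    have hx : x = 0 := pow_eq_zero_iff two_ne_zero |>.1 (by linarith [sq_nonneg x])
    exact ⟨1, 0, by simp, by simp [hv, hw, hx]⟩
  · have hk := Real.sq_sqrt (sub_nonneg.2 h)
    set k := √(v ^ 2 + w ^ 2 - x ^ 2)
    refine ⟨(x * v - k * w) / (v ^ 2 + w ^ 2), (x * w + k * v) / (v ^ 2 + w ^ 2), ?_, ?_⟩
    · field_simp
      linear_combination (v ^ 2 + w ^ 2) * hk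
    · field_simp
      ring

/-- Every point of the circle satisfies the tangential condition, so the eigenvalues are `d`, from the
axis, and the values `(a + d + x) / 2` that are at least `a`, where `x` runs through the values of
`v c + w s` on the circle. -/
lemma mem_lorentzSpectrum_arrow_iff (a v w d lam : ℝ) :
    lam ∈ lorentzSpectrum (m := 2) (arrow a v w d) ↔
      lam = d ∨ (a ≤ lam ∧ (2 * lam - a - d) ^ 2 ≤ v ^ 2 + w ^ 2) := by
  have cs : ∀ c s : ℝ, (v * c + w * s) ^ 2 + (v * s - w * c) ^ 2
      = (v ^ 2 + w ^ 2) * (c ^ 2 + s ^ 2) := fun c s => by ring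
  rw [mem_lorentzSpectrum_two_iff]
  simp only [tangentialForm, rayForm, arrow, Matrix.of_apply, Matrix.cons_val', Matrix.cons_val_zero,
    Matrix.cons_val_one, Matrix.cons_val, zero_mul, add_zero, zero_add]
  constructor
  · rintro (⟨c, s, h, e0, e1, e2⟩ | ⟨c, s, h, -, e1, e2⟩)
    · by_cases ha : lam = a
      · right
        refine ⟨ha.ge, ?_⟩
        have : (v ^ 2 + w ^ 2) * (c ^ 2 + s ^ 2) ≤ (v ^ 2 + w ^ 2) * 1 :=
          mul_le_mul_of_nonneg_left h.le (by positivity)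
        have e : 2 * lam - a - d = v * c + w * s := by linarith
        rw [e]
        linarith [cs c s, sq_nonneg (v * s - w * c)]
      · left
        have hc : c = 0 := by
          by_contra hc
          exact ha (mul_right_cancel₀ hc e0).symm
        have hs : s = 0 := by
          by_contra hs
          exact ha (mul_right_cancel₀ hs e1).symm
        simp [hc, hs] at e2
        exact e2.symm
    · right
      have e : 2 * lam = a + (v * c + w * s + d) := by rw [e1]; linear_combination a * h
      refine ⟨by linarith, ?_⟩
      have e' : 2 * lam - a - d = v * c + w * s := by linarith
      rw [e']
      have := cs c s
      rw [h] at this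
      linarith [sq_nonneg (v * s - w * c)]
  · rintro (rfl | ⟨h1, h2⟩)
    · exact Or.inl ⟨0, 0, by simp⟩
    · obtain ⟨c, s, h, e⟩ := exists_unit_inner_eq h2
      exact Or.inr ⟨c, s, h, by ring, by linear_combination -e - a * h, by linarith⟩

lemma eq_arrow_iff (A : Matrix (Fin 3) (Fin 3) ℝ) :
    A = arrow (A 0 0) (A 2 0) (A 2 1) (A 2 2) ↔
      A 1 1 = A 0 0 ∧ A 0 1 = 0 ∧ A 1 0 = 0 ∧ A 0 2 = 0 ∧ A 1 2 = 0 := by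
  constructor
  · intro h
    refine ⟨?_, ?_, ?_, ?_, ?_⟩ <;> rw [h] <;> simp [arrow]
  · rintro ⟨h1, h2, h3, h4, h5⟩
    ext i j; fin_cases i <;> fin_cases j <;> simp [arrow, *]

open Polynomial in
/-- If `A` is not an arrow matrix, its tangential form cuts the unit circle in finitely many points:
their first coordinates are roots of a nonzero polynomial of degree at most four. -/
lemma finite_zeros_tangentialForm (A : Matrix (Fin 3) (Fin 3) ℝ)
    (hA : ∀ a v w d, A ≠ arrow a v w d) :
    {p : ℝ × ℝ | p.1 ^ 2 + p.2 ^ 2 = 1 ∧ tangentialForm A p.1 p.2 = 0}.Finite := by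
  -- Squaring `s * (α * c - β) = -(γ * c ^ 2 + δ * c - ε)` eliminates `s` from the system.
  set α := A 1 1 - A 0 0 with hα
  set β := A 0 2 with hβ
  set γ := A 1 0 + A 0 1 with hγ
  set δ := A 1 2 with hδ
  set ε := A 0 1 with hε
  let P : ℝ[X] := C (α ^ 2 + γ ^ 2) * X ^ 4 + C (2 * γ * δ - 2 * α * β) * X ^ 3
    + C (β ^ 2 - α ^ 2 + δ ^ 2 - 2 * γ * ε) * X ^ 2 + C (2 * α * β - 2 * δ * ε) * X
    + C (ε ^ 2 - β ^ 2)
  have hP : P ≠ 0 := by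
    intro h0
    have c4 : P.coeff 4 = α ^ 2 + γ ^ 2 := by
      simp [P, -map_add, -map_sub, -map_mul, -map_pow]
    have c2 : P.coeff 2 = β ^ 2 - α ^ 2 + δ ^ 2 - 2 * γ * ε := by
      simp [P, -map_add, -map_sub, -map_mul, -map_pow]
    have c0 : P.coeff 0 = ε ^ 2 - β ^ 2 := by simp [P, -map_add, -map_sub, -map_mul, -map_pow]
    rw [h0, coeff_zero] at c4 c2 c0
    have a0 : α = 0 := pow_eq_zero_iff two_ne_zero |>.1 (by linarith [sq_nonneg α, sq_nonneg γ])
    have g0 : γ = 0 := pow_eq_zero_iff two_ne_zero |>.1 (by linarith [sq_nonneg α, sq_nonneg γ])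
    rw [a0, g0] at c2
    have b0 : β = 0 := pow_eq_zero_iff two_ne_zero |>.1 (by linarith [sq_nonneg β, sq_nonneg δ])
    have d0 : δ = 0 := pow_eq_zero_iff two_ne_zero |>.1 (by linarith [sq_nonneg β, sq_nonneg δ])
    rw [b0] at c0
    have e0 : ε = 0 := pow_eq_zero_iff two_ne_zero |>.1 (by linarith)
    exact hA _ _ _ _ ((eq_arrow_iff A).2 ⟨by linarith, e0, by linarith, b0, d0⟩)
  have hfin : {c : ℝ | P.IsRoot c}.Finite := Polynomial.finite_setOfPred_isRoot hP
  refine ((hfin.image fun c => (c, √(1 - c ^ 2))).union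
    (hfin.image fun c => (c, -√(1 - c ^ 2)))).subset ?_
  rintro ⟨c, s⟩ ⟨h1, h2⟩
  simp only at h1 h2
  have hroot : P.IsRoot c := by
    have e : s * (α * c - β) = -(γ * c ^ 2 + δ * c - ε) := by
      unfold tangentialForm at h2
      rw [hα, hβ, hγ, hδ, hε]
      linear_combination h2 + A 0 1 * h1
    have e2 : (1 - c ^ 2) * (α * c - β) ^ 2 = (γ * c ^ 2 + δ * c - ε) ^ 2 := by
      have : s ^ 2 * (α * c - β) ^ 2 = (γ * c ^ 2 + δ * c - ε) ^ 2 := by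
        rw [← mul_pow, e, neg_sq]
      rw [← this]; linear_combination (-(α * c - β) ^ 2) * h1
    simp only [P, IsRoot.def, eval_add, eval_mul, eval_C, eval_pow, eval_X]
    linear_combination -e2
  have hs : √(1 - c ^ 2) = |s| := by rw [← Real.sqrt_sq_eq_abs]; congr 1; linarith
  rcases le_total 0 s with h | h
  · exact Or.inl ⟨c, hroot, by simp [hs, abs_of_nonneg h]⟩
  · exact Or.inr ⟨c, hroot, by simp [hs, abs_of_nonpos h]⟩

lemma finite_lorentzSpectrum (A : Matrix (Fin 3) (Fin 3) ℝ)
    (hA : ∀ a v w d, A ≠ arrow a v w d) : (lorentzSpectrum (m := 2) A).Finite := by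
  refine (A.finite_real_spectrum.union
    ((finite_zeros_tangentialForm A hA).image fun p => rayForm A p.1 p.2 / 2)).subset ?_
  intro lam hlam
  rcases (mem_lorentzSpectrum_two_iff A lam).1 hlam with
    ⟨c, s, -, e0, e1, e2⟩ | ⟨c, s, h, h0, h1, -⟩
  · left
    rw [← Matrix.spectrum_toLin']
    refine Module.End.HasEigenvalue.mem_spectrum
      (Module.End.hasEigenvalue_of_hasEigenvector (x := ![c, s, 1]) ⟨?_, ?_⟩)
    · rw [Module.End.mem_eigenspace_iff]
      ext i
      fin_cases i <;> simp [Matrix.mulVec, dotProduct, Fin.sum_univ_three, e0, e1, e2]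
    · intro h; simpa using congrFun h 2
  · exact Or.inr ⟨(c, s), ⟨h, h0⟩, by simp [← h1]⟩

/-! ### Rigidity of the spectrum on arrow matrices -/

/-- A nondegenerate interval together with a point below it determines the interval and the point. -/
lemma eq_of_insert_Icc_eq {d a b d' l h : ℝ} (hda : d < a) (hab : a < b)
    (H : ∀ x, (x = d ∨ (a ≤ x ∧ x ≤ b)) ↔ (x = d' ∨ (l ≤ x ∧ x ≤ h))) :
    d' = d ∧ l = a ∧ h = b := by
  have ha := (H a).1 (Or.inr ⟨le_rfl, hab.le⟩)
  have hb := (H b).1 (Or.inr ⟨hab.le, le_rfl⟩)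
  have hm := (H ((a + b) / 2)).1 (Or.inr ⟨by linarith, by linarith⟩)
  have hlh : l < h := by
    rcases ha with ha | ha <;> rcases hb with hb | hb <;> rcases hm with hm | hm <;> linarith
  have hd : ¬ (l ≤ d ∧ d ≤ h) := by
    rintro ⟨h1, h2⟩
    rcases h2.lt_or_eq with h2 | h2
    · have h3 : d < min h ((a + d) / 2) := lt_min h2 (by linarith)
      have h4 : min h ((a + d) / 2) < a := (min_le_right _ _).trans_lt (by linarith)
      rcases (H (min h ((a + d) / 2))).2 (Or.inr ⟨by linarith, min_le_left _ _⟩) with h5 | h5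
      · exact h3.ne' h5
      · exact h4.not_ge h5.1
    · rcases (H l).2 (Or.inr ⟨le_rfl, hlh.le⟩) with h5 | h5 <;> linarith
  have hdd : d = d' := ((H d).1 (Or.inl rfl)).resolve_right hd
  subst hdd
  have ha' := ha.resolve_left hda.ne'
  have hb' := hb.resolve_left (hda.trans hab).ne'
  have hl := ((H l).2 (Or.inr ⟨le_rfl, hlh.le⟩)).resolve_left
    fun e => hd ⟨e.le, by linarith⟩
  have hh := ((H h).2 (Or.inr ⟨hlh.le, le_rfl⟩)).resolve_left
    fun e => hd ⟨by linarith, e.ge⟩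
  exact ⟨rfl, le_antisymm ha'.1 hl.1, le_antisymm hh.2 hb'.2⟩

lemma mem_lorentzSpectrum_arrow_iff_mem_Icc (a v w d lam : ℝ) :
    lam ∈ lorentzSpectrum (m := 2) (arrow a v w d) ↔
      lam = d ∨ (max a ((a + d - √(v ^ 2 + w ^ 2)) / 2) ≤ lam ∧
        lam ≤ (a + d + √(v ^ 2 + w ^ 2)) / 2) := by
  rw [mem_lorentzSpectrum_arrow_iff, max_le_iff, and_assoc,
    Real.sq_le (by positivity)]
  constructor
  · rintro (h | ⟨h1, h2, h3⟩)
    · exact Or.inl h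
    · exact Or.inr ⟨h1, by linarith, by linarith⟩
  · rintro (h | ⟨h1, h2, h3⟩)
    · exact Or.inl h
    · exact Or.inr ⟨h1, by linarith, by linarith⟩

lemma lorentzSpectrum_arrow_of_lt {a v w d : ℝ} (hd : d < a)
    (h : (a - d) ^ 2 < v ^ 2 + w ^ 2) :
    a < (a + d + √(v ^ 2 + w ^ 2)) / 2 ∧ ∀ lam, lam ∈ lorentzSpectrum (m := 2) (arrow a v w d) ↔
      lam = d ∨ (a ≤ lam ∧ lam ≤ (a + d + √(v ^ 2 + w ^ 2)) / 2) := by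
  have h1 : a - d < √(v ^ 2 + w ^ 2) := Real.lt_sqrt_of_sq_lt h
  refine ⟨by linarith, fun lam => ?_⟩
  rw [mem_lorentzSpectrum_arrow_iff_mem_Icc, max_eq_left (by linarith)]

lemma infinite_lorentzSpectrum_arrow {a v w d : ℝ} (hd : d < a)
    (h : (a - d) ^ 2 < v ^ 2 + w ^ 2) : (lorentzSpectrum (m := 2) (arrow a v w d)).Infinite := by
  obtain ⟨h1, h2⟩ := lorentzSpectrum_arrow_of_lt hd h
  exact (Set.Icc_infinite h1).mono fun x hx => (h2 x).2 (Or.inr hx)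

lemma arrow_rigid {a v w d a' v' w' d' : ℝ} (hd : d < a) (h : (a - d) ^ 2 < v ^ 2 + w ^ 2)
    (H : lorentzSpectrum (m := 2) (arrow a v w d)
      = lorentzSpectrum (m := 2) (arrow a' v' w' d')) :
    a' = a ∧ d' = d ∧ v' ^ 2 + w' ^ 2 = v ^ 2 + w ^ 2 := by
  obtain ⟨h1, h2⟩ := lorentzSpectrum_arrow_of_lt hd h
  have H' := fun x => (h2 x).symm.trans
    ((Set.ext_iff.1 H x).trans (mem_lorentzSpectrum_arrow_iff_mem_Icc a' v' w' d' x))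
  obtain ⟨e1, e2, e3⟩ := eq_of_insert_Icc_eq hd h1 H'
  subst e1
  have ha : a' = a := by
    rcases max_cases a' ((a' + d' - √(v' ^ 2 + w' ^ 2)) / 2) with ⟨e, -⟩ | ⟨e, e'⟩
    · rw [← e2, e]
    · rw [e] at e2
      linarith [Real.sqrt_nonneg (v' ^ 2 + w' ^ 2)]
  subst ha
  refine ⟨rfl, rfl, ?_⟩
  have : √(v' ^ 2 + w' ^ 2) = √(v ^ 2 + w ^ 2) := by linarith
  exact (Real.sqrt_inj (by positivity) (by positivity)).1 this

lemma exists_eq_arrow_of_infinite {A : Matrix (Fin 3) (Fin 3) ℝ}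
    (h : (lorentzSpectrum (m := 2) A).Infinite) : ∃ a v w d, A = arrow a v w d := by
  by_contra! hA
  exact h (finite_lorentzSpectrum A hA)

section

variable {φ : Matrix (Fin 3) (Fin 3) ℝ →ₗ[ℝ] Matrix (Fin 3) (Fin 3) ℝ}

/-- The infinite spectrum of an arrow matrix with `d < a` and `(a - d)² < v² + w²` forces its image to be
an arrow matrix, with the same `a`, `d` and `v² + w²`. -/
lemma map_arrow_of_lt (hφ : IsLorentzSpectrumPreserver (m := 2) φ) {a v w d : ℝ} (hd : d < a)
    (h : (a - d) ^ 2 < v ^ 2 + w ^ 2) :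
    ∃ v' w', φ (arrow a v w d) = arrow a v' w' d ∧ v' ^ 2 + w' ^ 2 = v ^ 2 + w ^ 2 := by
  have hs := hφ (arrow a v w d)
  obtain ⟨a', v', w', d', e⟩ := exists_eq_arrow_of_infinite
    (hs ▸ infinite_lorentzSpectrum_arrow hd h : (lorentzSpectrum (m := 2) (φ _)).Infinite)
  rw [e] at hs
  obtain ⟨rfl, rfl, h'⟩ := arrow_rigid hd h hs
  exact ⟨v', w', e, h'⟩

/-- The inequalities in `map_arrow_of_lt` hold after adding a large multiple of `arrow 1 2 0 0`, so
linearity removes them. -/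
lemma map_arrow (hφ : IsLorentzSpectrumPreserver (m := 2) φ) (a v w d : ℝ) :
    ∃ v' w', φ (arrow a v w d) = arrow a v' w' d ∧ v' ^ 2 + w' ^ 2 = v ^ 2 + w ^ 2 := by
  obtain ⟨p, q, hC, hpq⟩ := map_arrow_of_lt hφ (a := 1) (v := 2) (w := 0) (d := 0)
    (by norm_num) (by norm_num)
  have key : ∀ t, |a - d| + |v| < t → ∃ v' w', φ (arrow a v w d) = arrow a v' w' d ∧
      (v' + t * p) ^ 2 + (w' + t * q) ^ 2 = (v + t * 2) ^ 2 + w ^ 2 := by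
    intro t ht
    have h1 := neg_abs_le (a - d)
    have h2 := le_abs_self (a - d)
    have h3 := neg_abs_le v
    have h4 := abs_nonneg v
    have h5 := abs_nonneg (a - d)
    have h6 : (a + t - d) ^ 2 < (v + t * 2) ^ 2 := by
      rw [sq_lt_sq, abs_of_pos (by linarith), abs_of_pos (by linarith)]
      linarith
    obtain ⟨v', w', e, h⟩ := map_arrow_of_lt hφ (a := a + t) (v := v + t * 2) (w := w) (d := d)
      (by linarith) (by linarith [sq_nonneg w])
    refine ⟨v' - t * p, w' - t * q, ?_, by simpa using h⟩
    have hsum : arrow a v w d = arrow (a + t) (v + t * 2) w d - t • arrow 1 2 0 0 := by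
      rw [smul_arrow, arrow_sub]; simp
    rw [hsum, map_sub, map_smul, e, hC, smul_arrow, arrow_sub]; simp
  obtain ⟨v₁, w₁, e₁, h₁⟩ := key (|a - d| + |v| + 1) (by linarith)
  obtain ⟨v₂, w₂, e₂, h₂⟩ := key (|a - d| + |v| + 2) (by linarith)
  obtain ⟨-, rfl, rfl, -⟩ := arrow_inj (e₁.symm.trans e₂)
  refine ⟨v₁, w₁, e₁, ?_⟩
  -- The norms of `(v₁ + t p, w₁ + t q)` and `(v + 2 t, w)` agree for two values of `t`, and
  -- their squares are polynomials in `t` with the same quadratic coefficient.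
  generalize |a - d| + |v| = t at h₁ h₂
  linear_combination (t + 2) * h₁ - (t + 1) * h₂ + (t + 1) * (t + 2) * hpq

end

/-! ### Preservers fixing arrow matrices: zeros of the tangential form -/

lemma tangentialForm_add_arrow (A : Matrix (Fin 3) (Fin 3) ℝ) (a v w d c s : ℝ) :
    tangentialForm (A + arrow a v w d) c s = tangentialForm A c s := by
  simp [tangentialForm, arrow]; ring

lemma rayForm_add_arrow (A : Matrix (Fin 3) (Fin 3) ℝ) (a v w d c s : ℝ) :
    rayForm (A + arrow a v w d) c s
      = rayForm A c s + (a * (c ^ 2 + s ^ 2) + v * c + w * s + d) := by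
  simp [rayForm, arrow]; ring

open Polynomial in
lemma coeffs_eq_zero_of_infinite_zeros {a b c : ℝ}
    (h : {t : ℝ | a + b * t + c * t ^ 2 = 0}.Infinite) : a = 0 ∧ b = 0 ∧ c = 0 := by
  have h0 : (C a + C b * X + C c * X ^ 2 : ℝ[X]) = 0 := by
    refine eq_zero_of_infinite_isRoot _ (h.mono fun t ht => ?_)
    simpa [IsRoot.def] using ht
  refine ⟨?_, ?_, ?_⟩
  · simpa using congrArg (coeff · 0) h0
  · simpa [coeff_X, coeff_C] using congrArg (coeff · 1) h0
  · simpa [coeff_X, coeff_C] using congrArg (coeff · 2) h0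

section

variable {ψ : Matrix (Fin 3) (Fin 3) ℝ →ₗ[ℝ] Matrix (Fin 3) (Fin 3) ℝ}

/-- If `ψ A` were an arrow matrix, then `A` would differ from one by an element of the kernel of `ψ`,
whose addition does not affect the infinite spectrum of `arrow 1 2 0 0`. -/
lemma map_ne_arrow (hψ : IsLorentzSpectrumPreserver (m := 2) ψ)
    (hid : ∀ a v w d, ψ (arrow a v w d) = arrow a v w d) {A : Matrix (Fin 3) (Fin 3) ℝ}
    (hA : ∀ a v w d, A ≠ arrow a v w d) (a v w d : ℝ) : ψ A ≠ arrow a v w d := by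
  intro h
  have h1 : ψ (A - arrow a v w d + arrow 1 2 0 0) = arrow 1 2 0 0 := by
    rw [map_add, map_sub, h, hid, hid, sub_self, zero_add]
  have h2 := hψ (A - arrow a v w d + arrow 1 2 0 0)
  have h3 := infinite_lorentzSpectrum_arrow (a := 1) (v := 2) (w := 0) (d := 0)
    (by norm_num) (by norm_num)
  rw [h1] at h2
  rw [← h2] at h3
  obtain ⟨a', v', w', d', e⟩ := exists_eq_arrow_of_infinite h3
  refine hA (a' + a - 1) (v' + v - 2) (w' + w) (d' + d) ?_
  have : A = arrow a' v' w' d' + arrow a v w d - arrow 1 2 0 0 := by rw [← e]; abel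
  rw [this, arrow_add, arrow_sub, sub_zero, sub_zero]

/-- For large `d`, the matrix `A + arrow 0 v w d` has the boundary eigenvalue coming from the zero
`(c₀, s₀)`, and its image has to produce this eigenvalue from a zero of its own tangential form. -/
lemma exists_zero_rayForm_eq (hψ : IsLorentzSpectrumPreserver (m := 2) ψ)
    (hid : ∀ a v w d, ψ (arrow a v w d) = arrow a v w d) (A : Matrix (Fin 3) (Fin 3) ℝ)
    {c₀ s₀ : ℝ} (h₀ : c₀ ^ 2 + s₀ ^ 2 = 1) (hg : tangentialForm A c₀ s₀ = 0) (v w : ℝ) :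
    ∃ c s : ℝ, (c ^ 2 + s ^ 2 = 1 ∧ tangentialForm (ψ A) c s = 0) ∧
      rayForm A c₀ s₀ + (v * c₀ + w * s₀) = rayForm (ψ A) c s + (v * c + w * s) := by
  obtain ⟨m, hm⟩ : ∃ m, m = A 2 0 * c₀ + A 2 1 * s₀ + A 2 2 := ⟨_, rfl⟩
  obtain ⟨q, hq⟩ : ∃ q, q = rayForm A c₀ s₀ + (v * c₀ + w * s₀) := ⟨_, rfl⟩
  -- With this `d`, the sign condition holds at `(c₀, s₀)`, and the last row excludes an interior
  -- eigenvector of the image for the eigenvalue `(q + d) / 2`.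
  obtain ⟨d, hd⟩ : ∃ d, d = |q| + 2 * |m + (v * c₀ + w * s₀)| + 1
    + 2 * (|ψ A 2 0 + v| + |ψ A 2 1 + w| + |ψ A 2 2|) := ⟨_, rfl⟩
  have hmem : (q + d) / 2 ∈ lorentzSpectrum (m := 2) (A + arrow 0 v w d) := by
    refine (mem_lorentzSpectrum_two_iff _ _).2 (Or.inr ⟨c₀, s₀, h₀, ?_, ?_, ?_⟩)
    · rw [tangentialForm_add_arrow, hg]
    · rw [rayForm_add_arrow, hq]; ring
    · have e : (A + arrow 0 v w d) 2 0 * c₀ + (A + arrow 0 v w d) 2 1 * s₀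
          + (A + arrow 0 v w d) 2 2 = m + (v * c₀ + w * s₀) + d := by
        rw [hm]; simp [arrow]; ring
      rw [e]
      linarith [le_abs_self q, neg_abs_le (m + (v * c₀ + w * s₀)), abs_nonneg (ψ A 2 0 + v),
        abs_nonneg (ψ A 2 1 + w), abs_nonneg (ψ A 2 2)]
  rw [hψ, map_add, hid] at hmem
  rcases (mem_lorentzSpectrum_two_iff _ _).1 hmem with
    ⟨c, s, h, -, -, h2⟩ | ⟨c, s, h, h1, h2, -⟩
  · exfalso
    have e : (ψ A + arrow 0 v w d) 2 0 * c + (ψ A + arrow 0 v w d) 2 1 * s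
        + (ψ A + arrow 0 v w d) 2 2 = (ψ A 2 0 + v) * c + (ψ A 2 1 + w) * s + ψ A 2 2 + d := by
      simp [arrow]; ring
    rw [e] at h2
    have hc : |c| ≤ 1 := by rw [← sq_le_one_iff_abs_le_one]; linarith [sq_nonneg s]
    have hs : |s| ≤ 1 := by rw [← sq_le_one_iff_abs_le_one]; linarith [sq_nonneg c]
    have b1 : |(ψ A 2 0 + v) * c| ≤ |ψ A 2 0 + v| := by
      rw [abs_mul]; exact mul_le_of_le_one_right (abs_nonneg _) hc
    have b2 : |(ψ A 2 1 + w) * s| ≤ |ψ A 2 1 + w| := by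
      rw [abs_mul]; exact mul_le_of_le_one_right (abs_nonneg _) hs
    linarith [neg_abs_le ((ψ A 2 0 + v) * c), neg_abs_le ((ψ A 2 1 + w) * s),
      neg_abs_le (ψ A 2 2), le_abs_self q, abs_nonneg (m + (v * c₀ + w * s₀))]
  · rw [tangentialForm_add_arrow] at h1
    rw [rayForm_add_arrow] at h2
    exact ⟨c, s, ⟨h, h1⟩, by linarith⟩

/-- The zeros of `tangentialForm (ψ A)` are finite in number, so one of them serves for infinitely many
of the pairs `(v, w) = (t, t²)` in `exists_zero_rayForm_eq`. It can only be `(c₀, s₀)`. -/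
lemma tangentialForm_rayForm_map_of_zero (hψ : IsLorentzSpectrumPreserver (m := 2) ψ)
    (hid : ∀ a v w d, ψ (arrow a v w d) = arrow a v w d) (A : Matrix (Fin 3) (Fin 3) ℝ)
    {c₀ s₀ : ℝ} (h₀ : c₀ ^ 2 + s₀ ^ 2 = 1) (hg : tangentialForm A c₀ s₀ = 0) :
    tangentialForm (ψ A) c₀ s₀ = 0 ∧ rayForm (ψ A) c₀ s₀ = rayForm A c₀ s₀ := by
  by_cases hA : ∃ a v w d, A = arrow a v w d
  · obtain ⟨a, v, w, d, rfl⟩ := hA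
    rw [hid]
    exact ⟨hg, rfl⟩
  push Not at hA
  have hfin := finite_zeros_tangentialForm (ψ A) (map_ne_arrow hψ hid hA)
  choose c s hcs hq using fun t : ℝ => exists_zero_rayForm_eq hψ hid A h₀ hg t (t ^ 2)
  have := hfin.to_subtype
  obtain ⟨⟨⟨c₁, s₁⟩, h₁, hg₁⟩, hinf⟩ := Finite.exists_infinite_fiber
    fun t : ℝ => (⟨(c t, s t), hcs t⟩ :
      {p : ℝ × ℝ | p.1 ^ 2 + p.2 ^ 2 = 1 ∧ tangentialForm (ψ A) p.1 p.2 = 0})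
  obtain ⟨e0, e1, e2⟩ := coeffs_eq_zero_of_infinite_zeros
    (a := rayForm A c₀ s₀ - rayForm (ψ A) c₁ s₁) (b := c₀ - c₁) (c := s₀ - s₁)
    ((Set.infinite_coe_iff.1 hinf).mono fun t ht => by
      have ht' := congrArg Subtype.val ht
      simp only [Prod.mk.injEq] at ht'
      have := hq t
      rw [ht'.1, ht'.2] at this
      simp only [Set.mem_ofPred_eq]
      linarith)
  obtain rfl : c₀ = c₁ := by linarith
  obtain rfl : s₀ = s₁ := by linarith
  exact ⟨hg₁, by linarith⟩

end

/-! ### Preservers fixing arrow matrices are the identity -/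

lemma tangentialForm_add (A B : Matrix (Fin 3) (Fin 3) ℝ) (c s : ℝ) :
    tangentialForm (A + B) c s = tangentialForm A c s + tangentialForm B c s := by
  simp [tangentialForm]; ring

lemma tangentialForm_smul (t : ℝ) (A : Matrix (Fin 3) (Fin 3) ℝ) (c s : ℝ) :
    tangentialForm (t • A) c s = t * tangentialForm A c s := by
  simp [tangentialForm]; ring

lemma rayForm_add (A B : Matrix (Fin 3) (Fin 3) ℝ) (c s : ℝ) :
    rayForm (A + B) c s = rayForm A c s + rayForm B c s := by
  simp [rayForm]; ring

lemma rayForm_smul (t : ℝ) (A : Matrix (Fin 3) (Fin 3) ℝ) (c s : ℝ) :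
    rayForm (t • A) c s = t * rayForm A c s := by
  simp [rayForm]; ring

/-- The generator of the rotations about the axis of the cone. On the unit circle its tangential form
is `1` and its ray form is `0`. -/
def planarRotation : Matrix (Fin 3) (Fin 3) ℝ := !![0, -1, 0; 1, 0, 0; 0, 0, 0]

lemma tangentialForm_planarRotation {c s : ℝ} (h : c ^ 2 + s ^ 2 = 1) :
    tangentialForm planarRotation c s = 1 := by
  simp [tangentialForm, planarRotation]; linarith

lemma rayForm_planarRotation (c s : ℝ) : rayForm planarRotation c s = 0 := by
  simp [rayForm, planarRotation]; ring

/-- If the product of a trigonometric polynomial of degree at most two and `-2 s c` has degree at most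
two, then the former is constant. It is enough to evaluate at rational points of the circle. -/
lemma tangentialForm_const_of_mul {R S : Matrix (Fin 3) (Fin 3) ℝ}
    (h : ∀ c s : ℝ, c ^ 2 + s ^ 2 = 1 →
      tangentialForm S c s = (-2 * s * c) * tangentialForm R c s) :
    (R 1 1 = R 0 0 ∧ R 1 0 = - R 0 1 ∧ R 1 2 = 0 ∧ R 0 2 = 0) ∧
      (S 1 0 = 0 ∧ S 0 1 = 0 ∧ S 1 2 = 0 ∧ S 0 2 = 0 ∧ S 1 1 - S 0 0 = -2 * R 1 0) := by
  have a1 := h 1 0 (by norm_num)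
  have a2 := h (-1) 0 (by norm_num)
  have a3 := h 0 1 (by norm_num)
  have a4 := h 0 (-1) (by norm_num)
  have a5 := h (3/5) (4/5) (by norm_num)
  have a6 := h (-3/5) (4/5) (by norm_num)
  have a7 := h (3/5) (-4/5) (by norm_num)
  have a8 := h (-3/5) (-4/5) (by norm_num)
  have a9 := h (4/5) (3/5) (by norm_num)
  have a10 := h (-4/5) (3/5) (by norm_num)
  clear h
  simp only [tangentialForm] at a1 a2 a3 a4 a5 a6 a7 a8 a9 a10
  have s10 : S 1 0 = 0 := by linarith
  have s01 : S 0 1 = 0 := by linarith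
  have s12 : S 1 2 = 0 := by linarith
  have s02 : S 0 2 = 0 := by linarith
  clear a1 a2 a3 a4
  rw [s10, s01, s12, s02] at a5 a6 a7 a8 a9 a10
  have r12 : R 1 2 = 0 := by linarith
  have r02 : R 0 2 = 0 := by linarith
  rw [r12, r02] at a5 a6 a7 a8 a9 a10
  have r11 : R 1 1 = R 0 0 := by linarith
  have r10 : R 1 0 = - R 0 1 := by linarith
  exact ⟨⟨r11, r10, r12, r02⟩, s10, s01, s12, s02, by linarith⟩

/-- Here `R` and `S` are the images of `planarRotation` and of `diag(1, -1, 0)`, whose tangential and ray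
forms are `-2 s c` and `c² - s²`. -/
lemma multipliers_of_mul {R S : Matrix (Fin 3) (Fin 3) ℝ}
    (h : ∀ c s : ℝ, c ^ 2 + s ^ 2 = 1 →
      tangentialForm S c s = (-2 * s * c) * tangentialForm R c s ∧
      rayForm S c s = (c ^ 2 - s ^ 2) + (-2 * s * c) * rayForm R c s) {c s : ℝ}
    (hcs : c ^ 2 + s ^ 2 = 1) : tangentialForm R c s = 1 ∧ rayForm R c s = 0 := by
  obtain ⟨⟨r11, r10, r12, r02⟩, s10, s01, s12, s02, s11⟩ :=
    tangentialForm_const_of_mul fun c s hcs => (h c s hcs).1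
  have a1 := (h 1 0 (by norm_num)).2
  have a2 := (h (-1) 0 (by norm_num)).2
  have a3 := (h 0 1 (by norm_num)).2
  have a4 := (h 0 (-1) (by norm_num)).2
  have a5 := (h (3/5) (4/5) (by norm_num)).2
  have a6 := (h (-3/5) (4/5) (by norm_num)).2
  have a7 := (h (3/5) (-4/5) (by norm_num)).2
  have a8 := (h (-3/5) (-4/5) (by norm_num)).2
  clear h
  simp only [rayForm, r11, r10, r12, r02, s10, s01, s12, s02] at a1 a2 a3 a4 a5 a6 a7 a8
  have s20 : S 2 0 = 0 := by linarith
  have s21 : S 2 1 = 0 := by linarith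
  have hR : R 1 0 = 1 := by linarith
  have r20 : R 2 0 = 0 := by linarith
  have r21 : R 2 1 = 0 := by linarith
  have r22 : R 2 2 = - R 0 0 := by linarith
  have r01 : R 0 1 = -1 := by linarith
  simp only [tangentialForm, rayForm, r11, hR, r12, r02, r20, r21, r22, r01]
  constructor
  · linear_combination hcs
  · linear_combination R 0 0 * hcs

section

variable {ψ : Matrix (Fin 3) (Fin 3) ℝ →ₗ[ℝ] Matrix (Fin 3) (Fin 3) ℝ}

/-- Subtracting `tangentialForm A c s • planarRotation` from `A` makes the tangential form vanish at
`(c, s)`. -/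
lemma map_forms_eq_add_mul (hψ : IsLorentzSpectrumPreserver (m := 2) ψ)
    (hid : ∀ a v w d, ψ (arrow a v w d) = arrow a v w d) (A : Matrix (Fin 3) (Fin 3) ℝ)
    {c s : ℝ} (h : c ^ 2 + s ^ 2 = 1) :
    tangentialForm (ψ A) c s = tangentialForm A c s * tangentialForm (ψ planarRotation) c s ∧
      rayForm (ψ A) c s
        = rayForm A c s + tangentialForm A c s * rayForm (ψ planarRotation) c s := by
  obtain ⟨h1, h2⟩ := tangentialForm_rayForm_map_of_zero hψ hid
    (A + (-tangentialForm A c s) • planarRotation) h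
    (by rw [tangentialForm_add, tangentialForm_smul, tangentialForm_planarRotation h]; ring)
  rw [map_add, map_smul, tangentialForm_add, tangentialForm_smul] at h1
  rw [map_add, map_smul, rayForm_add, rayForm_smul, rayForm_add, rayForm_smul,
    rayForm_planarRotation] at h2
  exact ⟨by linarith, by linarith⟩

lemma map_forms_eq (hψ : IsLorentzSpectrumPreserver (m := 2) ψ)
    (hid : ∀ a v w d, ψ (arrow a v w d) = arrow a v w d) (A : Matrix (Fin 3) (Fin 3) ℝ)
    {c s : ℝ} (h : c ^ 2 + s ^ 2 = 1) :
    tangentialForm (ψ A) c s = tangentialForm A c s ∧ rayForm (ψ A) c s = rayForm A c s := by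
  obtain ⟨h1, h2⟩ := map_forms_eq_add_mul hψ hid A h
  obtain ⟨e1, e2⟩ := multipliers_of_mul (R := ψ planarRotation)
    (S := ψ !![1, 0, 0; 0, -1, 0; 0, 0, 0]) (fun c s hcs => by
      obtain ⟨k1, k2⟩ := map_forms_eq_add_mul hψ hid !![1, 0, 0; 0, -1, 0; 0, 0, 0] hcs
      have t1 : tangentialForm !![1, 0, 0; 0, -1, 0; 0, 0, 0] c s = -2 * s * c := by
        simp [tangentialForm]; ring
      have t2 : rayForm !![1, 0, 0; 0, -1, 0; 0, 0, 0] c s = c ^ 2 - s ^ 2 := by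
        simp [rayForm]; ring
      rw [t1] at k1 k2
      rw [t2] at k2
      exact ⟨k1, k2⟩) h
  rw [e1, mul_one] at h1
  rw [e2, mul_zero, add_zero] at h2
  exact ⟨h1, h2⟩

/-- The tangential and ray forms on the circle determine a matrix up to multiples of
`diag(1, 1, -1)`. -/
lemma eq_add_arrow_of_forms_eq {A B : Matrix (Fin 3) (Fin 3) ℝ}
    (h : ∀ c s : ℝ, c ^ 2 + s ^ 2 = 1 →
      tangentialForm B c s = tangentialForm A c s ∧ rayForm B c s = rayForm A c s) :
    ∃ α, B = A + arrow α 0 0 (-α) := by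
  obtain ⟨a1, b1⟩ := h 1 0 (by norm_num)
  obtain ⟨a2, b2⟩ := h (-1) 0 (by norm_num)
  obtain ⟨a3, b3⟩ := h 0 1 (by norm_num)
  obtain ⟨a4, b4⟩ := h 0 (-1) (by norm_num)
  obtain ⟨a5, -⟩ := h (3/5) (4/5) (by norm_num)
  simp only [tangentialForm, rayForm] at a1 a2 a3 a4 a5 b1 b2 b3 b4
  have n10 : B 1 0 = A 1 0 := by linarith
  have n01 : B 0 1 = A 0 1 := by linarith
  have n12 : B 1 2 = A 1 2 := by linarith
  have n02 : B 0 2 = A 0 2 := by linarith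
  refine ⟨B 0 0 - A 0 0, ?_⟩
  ext i j
  fin_cases i <;> fin_cases j <;> simp [arrow] <;> linarith

/-- The hypothesis says that `A + arrow (-M) 0 0 0` has an interior eigenvector for the eigenvalue `0`,
for arbitrarily large `M`. The image is `A + arrow (α - M) 0 0 (-α)`. Its boundary eigenvalues are
negative for large `M`, and its interior ones equal `-α` by the last row. -/
lemma map_eq_of_interior (hψ : IsLorentzSpectrumPreserver (m := 2) ψ)
    (hid : ∀ a v w d, ψ (arrow a v w d) = arrow a v w d) {A : Matrix (Fin 3) (Fin 3) ℝ}
    (h20 : A 2 0 = 0) (h21 : A 2 1 = 0) (h22 : A 2 2 = 0)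
    (h : ∀ K : ℝ, ∃ M, K < M ∧ ∃ c s : ℝ, c ^ 2 + s ^ 2 < 1 ∧
      A 0 0 * c + A 0 1 * s + A 0 2 = M * c ∧ A 1 0 * c + A 1 1 * s + A 1 2 = M * s) :
    ψ A = A := by
  obtain ⟨α, hα⟩ := eq_add_arrow_of_forms_eq fun c s hcs => map_forms_eq hψ hid A hcs
  obtain ⟨M, hM, c, s, hcs, e0, e1⟩ :=
    h ((|A 0 0| + |A 0 1| + |A 0 2|) + (|A 1 0| + |A 1 1| + |A 1 2|))
  have hmem : 0 ∈ lorentzSpectrum (m := 2) (A + arrow (-M) 0 0 0) :=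
    (mem_lorentzSpectrum_two_iff _ _).2 (Or.inl ⟨c, s, hcs, by simp [arrow]; linarith,
      by simp [arrow]; linarith, by simp [arrow, h20, h21, h22]⟩)
  rw [hψ, map_add, hid, hα, add_assoc, arrow_add] at hmem
  have hα0 : α = 0 := by
    rcases (mem_lorentzSpectrum_two_iff _ _).1 hmem with
      ⟨c, s, -, -, -, h2⟩ | ⟨c, s, h, -, h2, -⟩
    · simpa [arrow, h20, h21, h22] using h2
    · exfalso
      rw [rayForm_add_arrow, h] at h2
      have hc : |c| ≤ 1 := by rw [← sq_le_one_iff_abs_le_one]; linarith [sq_nonneg s]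
      have hs : |s| ≤ 1 := by rw [← sq_le_one_iff_abs_le_one]; linarith [sq_nonneg c]
      have bound : ∀ x y z t : ℝ, |t| ≤ 1 → t * (x * c + y * s + z) ≤ |x| + |y| + |z| := by
        intro x y z t ht
        have k1 : |x * c| ≤ |x| := by
          rw [abs_mul]; exact mul_le_of_le_one_right (abs_nonneg _) hc
        have k2 : |y * s| ≤ |y| := by
          rw [abs_mul]; exact mul_le_of_le_one_right (abs_nonneg _) hs
        calc t * (x * c + y * s + z) ≤ |t * (x * c + y * s + z)| := le_abs_self _
          _ ≤ |x * c + y * s + z| := by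
            rw [abs_mul]; exact mul_le_of_le_one_left (abs_nonneg _) ht
          _ ≤ |x * c| + |y * s| + |z| := abs_add_three _ _ _
          _ ≤ |x| + |y| + |z| := by linarith
      have b1 := bound (A 0 0) (A 0 1) (A 0 2) c hc
      have b2 := bound (A 1 0) (A 1 1) (A 1 2) s hs
      simp only [rayForm, h20, h21, h22] at h2
      linarith
  rw [hα, hα0]
  ext i j
  fin_cases i <;> fin_cases j <;> simp [arrow]

lemma map_eq_self (hψ : IsLorentzSpectrumPreserver (m := 2) ψ)
    (hid : ∀ a v w d, ψ (arrow a v w d) = arrow a v w d) (A : Matrix (Fin 3) (Fin 3) ℝ) :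
    ψ A = A := by
  have h1 : ψ !![A 0 0, A 0 1, 0; A 1 0, A 1 1, 0; 0, 0, 0]
      = !![A 0 0, A 0 1, 0; A 1 0, A 1 1, 0; 0, 0, 0] :=
    map_eq_of_interior hψ hid (by simp) (by simp) (by simp)
      fun K => ⟨K + 1, by linarith, 0, 0, by simp, by simp, by simp⟩
  have h2 : ψ !![0, 0, A 0 2; 0, 0, A 1 2; 0, 0, 0] = !![0, 0, A 0 2; 0, 0, A 1 2; 0, 0, 0] := by
    refine map_eq_of_interior hψ hid (by simp) (by simp) (by simp) fun K => ?_
    obtain ⟨M, hM⟩ : ∃ M, M = |K| + 1 + (|A 0 2| + |A 1 2|) := ⟨_, rfl⟩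
    have k1 := abs_nonneg (A 0 2)
    have k2 := abs_nonneg (A 1 2)
    have k3 := abs_nonneg K
    have hM0 : 0 < M := by linarith
    refine ⟨M, by linarith [le_abs_self K], A 0 2 / M, A 1 2 / M, ?_, ?_, ?_⟩
    · have : A 0 2 ^ 2 + A 1 2 ^ 2 < M ^ 2 := by
        rw [← sq_abs (A 0 2), ← sq_abs (A 1 2)]
        have : (|A 0 2| + |A 1 2|) ^ 2 < M ^ 2 := by gcongr; linarith
        linarith [mul_nonneg k1 k2]
      rw [div_pow, div_pow, ← add_div, div_lt_one (by positivity)]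
      exact this
    · simp; field_simp
    · simp; field_simp
  have e : A = !![A 0 0, A 0 1, 0; A 1 0, A 1 1, 0; 0, 0, 0]
      + !![0, 0, A 0 2; 0, 0, A 1 2; 0, 0, 0] + arrow 0 (A 2 0) (A 2 1) (A 2 2) := by
    ext i j
    fin_cases i <;> fin_cases j <;> simp [arrow]
  conv_lhs => rw [e, map_add, map_add, h1, h2, hid]
  exact e.symm

end

/-! ### Isometries of the cone fixing its axis -/

/-- An orthogonal matrix that maps the Lorentz cone onto itself. Such a matrix is a rotation about the
axis of the cone or a reflection in a plane containing the axis. -/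
structure IsAxialIsometry (P : Matrix (Fin 3) (Fin 3) ℝ) : Prop where
  transpose_mul : Pᵀ * P = 1
  mul_transpose : P * Pᵀ = 1
  mulVec_mem_iff : ∀ x : Fin 3 → ℝ, P *ᵥ x ∈ lorentzCone 2 ↔ x ∈ lorentzCone 2

section

variable {P : Matrix (Fin 3) (Fin 3) ℝ}

lemma IsAxialIsometry.transpose (hP : IsAxialIsometry P) : IsAxialIsometry Pᵀ where
  transpose_mul := by rw [Matrix.transpose_transpose, hP.mul_transpose]
  mul_transpose := by rw [Matrix.transpose_transpose, hP.transpose_mul]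
  mulVec_mem_iff x := by
    rw [← hP.mulVec_mem_iff, Matrix.mulVec_mulVec, hP.mul_transpose, Matrix.one_mulVec]

/-- The homeomorphism `x ↦ P x` of `ℝ³`. -/
def IsAxialIsometry.homeomorph (hP : IsAxialIsometry P) : (Fin 3 → ℝ) ≃ₜ (Fin 3 → ℝ) where
  toFun x := P *ᵥ x
  invFun x := Pᵀ *ᵥ x
  left_inv x := by simp [Matrix.mulVec_mulVec, hP.transpose_mul]
  right_inv x := by simp [Matrix.mulVec_mulVec, hP.mul_transpose]
  continuous_toFun := by fun_prop
  continuous_invFun := by fun_prop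

lemma IsAxialIsometry.preimage_lorentzCone (hP : IsAxialIsometry P) :
    hP.homeomorph ⁻¹' lorentzCone 2 = lorentzCone 2 :=
  Set.ext hP.mulVec_mem_iff

lemma IsAxialIsometry.mulVec_mem_interior_iff (hP : IsAxialIsometry P) (x : Fin 3 → ℝ) :
    P *ᵥ x ∈ interior (lorentzCone 2) ↔ x ∈ interior (lorentzCone 2) := by
  conv_rhs => rw [← hP.preimage_lorentzCone, ← hP.homeomorph.preimage_interior]
  rfl

lemma IsAxialIsometry.mulVec_mem_frontier_iff (hP : IsAxialIsometry P) (x : Fin 3 → ℝ) :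
    P *ᵥ x ∈ frontier (lorentzCone 2) ↔ x ∈ frontier (lorentzCone 2) := by
  conv_rhs => rw [← hP.preimage_lorentzCone, ← hP.homeomorph.preimage_frontier]
  rfl

lemma IsAxialIsometry.isLorentzEigenvector_conj (hP : IsAxialIsometry P)
    {A : Matrix (Fin 3) (Fin 3) ℝ} {lam : ℝ} {x : Fin 3 → ℝ}
    (h : IsLorentzEigenvector (m := 2) A lam x) :
    IsLorentzEigenvector (m := 2) (P * A * Pᵀ) lam (P *ᵥ x) := by
  obtain ⟨h0, h1, h2, h3⟩ := h
  have e : (P * A * Pᵀ - lam • (1 : Matrix (Fin 3) (Fin 3) ℝ)) *ᵥ (P *ᵥ x)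
      = P *ᵥ ((A - lam • (1 : Matrix (Fin 3) (Fin 3) ℝ)) *ᵥ x) := by
    simp only [Matrix.mulVec_mulVec, Matrix.sub_mul, Matrix.mul_sub, Matrix.mul_assoc,
      hP.transpose_mul, Matrix.mul_one, Matrix.smul_mul, Matrix.one_mul, Matrix.mul_smul]
  refine ⟨?_, (hP.mulVec_mem_iff x).2 h1, ?_, ?_⟩
  · intro hx
    apply h0
    have := congrArg (Pᵀ *ᵥ ·) hx
    simpa [Matrix.mulVec_mulVec, hP.transpose_mul] using this
  · rw [e]
    exact (hP.mulVec_mem_iff _).2 h2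
  · rw [e, Matrix.dotProduct_mulVec, Matrix.vecMul_mulVec, hP.transpose_mul]
    simpa using h3

lemma IsAxialIsometry.spectra_subset (hP : IsAxialIsometry P) (A : Matrix (Fin 3) (Fin 3) ℝ) :
    lorentzSpectrum (m := 2) A ⊆ lorentzSpectrum (m := 2) (P * A * Pᵀ) ∧
    interiorLorentzSpectrum (m := 2) A ⊆ interiorLorentzSpectrum (m := 2) (P * A * Pᵀ) ∧
    boundaryLorentzSpectrum (m := 2) A ⊆ boundaryLorentzSpectrum (m := 2) (P * A * Pᵀ) := by
  refine ⟨?_, ?_, ?_⟩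
  · rintro lam ⟨x, hx⟩
    exact ⟨_, hP.isLorentzEigenvector_conj hx⟩
  · rintro lam ⟨x, hx, hx'⟩
    exact ⟨_, hP.isLorentzEigenvector_conj hx, (hP.mulVec_mem_interior_iff x).2 hx'⟩
  · rintro lam ⟨x, hx, hx'⟩
    exact ⟨_, hP.isLorentzEigenvector_conj hx, (hP.mulVec_mem_frontier_iff x).2 hx'⟩

lemma IsAxialIsometry.spectra_eq (hP : IsAxialIsometry P) (A : Matrix (Fin 3) (Fin 3) ℝ) :
    lorentzSpectrum (m := 2) A = lorentzSpectrum (m := 2) (P * A * Pᵀ) ∧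
    interiorLorentzSpectrum (m := 2) A = interiorLorentzSpectrum (m := 2) (P * A * Pᵀ) ∧
    boundaryLorentzSpectrum (m := 2) A = boundaryLorentzSpectrum (m := 2) (P * A * Pᵀ) := by
  obtain ⟨h1, h2, h3⟩ := hP.spectra_subset A
  obtain ⟨k1, k2, k3⟩ := hP.transpose.spectra_subset (P * A * Pᵀ)
  have e : Pᵀ * (P * A * Pᵀ) * Pᵀᵀ = A := by
    rw [Matrix.transpose_transpose, ← Matrix.mul_assoc, ← Matrix.mul_assoc, hP.transpose_mul,
      Matrix.one_mul, Matrix.mul_assoc, hP.transpose_mul, Matrix.mul_one]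
  rw [e] at k1 k2 k3
  exact ⟨h1.antisymm k1, h2.antisymm k2, h3.antisymm k3⟩

end

/-! ### Preservers are conjugations -/

lemma isAxialIsometry_of_orthonormal {p q r s : ℝ} (h1 : p ^ 2 + q ^ 2 = 1)
    (h2 : r ^ 2 + s ^ 2 = 1) (h3 : p * r + q * s = 0) :
    IsAxialIsometry !![p, r, 0; q, s, 0; 0, 0, 1] := by
  have hT : (!![p, r, 0; q, s, 0; 0, 0, 1] : Matrix (Fin 3) (Fin 3) ℝ)ᵀ
      * !![p, r, 0; q, s, 0; 0, 0, 1] = 1 := by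
    ext i j
    fin_cases i <;> fin_cases j <;>
      simp [Matrix.mul_apply, Fin.sum_univ_three] <;> linarith
  refine ⟨hT, mul_eq_one_comm.1 hT, fun x => ?_⟩
  rw [mem_lorentzCone_two_iff, mem_lorentzCone_two_iff]
  have e : (p * x 0 + r * x 1) ^ 2 + (q * x 0 + s * x 1) ^ 2 = x 0 ^ 2 + x 1 ^ 2 := by
    linear_combination x 0 ^ 2 * h1 + x 1 ^ 2 * h2 + 2 * x 0 * x 1 * h3
  simp [Matrix.mulVec, dotProduct, Fin.sum_univ_three, e]

section

variable {φ : Matrix (Fin 3) (Fin 3) ℝ →ₗ[ℝ] Matrix (Fin 3) (Fin 3) ℝ}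

lemma exists_isAxialIsometry_map_arrow (hφ : IsLorentzSpectrumPreserver (m := 2) φ) :
    ∃ P, IsAxialIsometry P ∧ ∀ a v w d, φ (arrow a v w d) = P * arrow a v w d * Pᵀ := by
  obtain ⟨p, q, h1, n1⟩ := map_arrow hφ 0 1 0 0
  obtain ⟨r, s, h2, n2⟩ := map_arrow hφ 0 0 1 0
  -- The norm of the image of `(1, 1)` gives the orthogonality of the images of the basis vectors.
  obtain ⟨x, y, h3, n3⟩ := map_arrow hφ 0 1 1 0
  obtain ⟨x₁, y₁, h4, n4⟩ := map_arrow hφ 1 0 0 0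
  obtain ⟨x₂, y₂, h5, n5⟩ := map_arrow hφ 0 0 0 1
  have e : arrow 0 1 1 0 = arrow 0 1 0 0 + arrow 0 0 1 0 := by rw [arrow_add]; simp
  rw [e, map_add, h1, h2, arrow_add] at h3
  obtain ⟨-, rfl, rfl, -⟩ := arrow_inj h3
  have z : ∀ {x y : ℝ}, x ^ 2 + y ^ 2 = 0 ^ 2 + 0 ^ 2 → x = 0 ∧ y = 0 := fun {x y} h =>
    ⟨pow_eq_zero_iff two_ne_zero |>.1 (by linarith [sq_nonneg x, sq_nonneg y]),
      pow_eq_zero_iff two_ne_zero |>.1 (by linarith [sq_nonneg x, sq_nonneg y])⟩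
  obtain ⟨rfl, rfl⟩ := z n4
  obtain ⟨rfl, rfl⟩ := z n5
  refine ⟨!![p, r, 0; q, s, 0; 0, 0, 1],
    isAxialIsometry_of_orthonormal (by linarith) (by linarith) (by linarith), fun a v w d => ?_⟩
  have hP := isAxialIsometry_of_orthonormal (p := p) (q := q) (r := r) (s := s)
    (by linarith) (by linarith) (by linarith)
  have e : arrow a v w d = a • arrow 1 0 0 0 + v • arrow 0 1 0 0 + w • arrow 0 0 1 0
      + d • arrow 0 0 0 1 := by
    simp [smul_arrow, arrow_add]
  have hL : φ (arrow a v w d) = arrow a (v * p + w * r) (v * q + w * s) d := by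
    rw [e, map_add, map_add, map_add, map_smul, map_smul, map_smul, map_smul, h1, h2, h4, h5]
    simp [smul_arrow, arrow_add]
  -- `P * X * Pᵀ = Y` is equivalent to `P * X = Y * P`
  have hcomm : !![p, r, 0; q, s, 0; 0, 0, 1] * arrow a v w d
      = arrow a (v * p + w * r) (v * q + w * s) d * !![p, r, 0; q, s, 0; 0, 0, 1] := by
    ext i j
    fin_cases i <;> fin_cases j <;> simp [arrow, Matrix.mul_apply, Fin.sum_univ_three]
    · ring
    · ring
    · ring
    · ring
    · linear_combination -v * n1 - w * (n3 - n1 - n2) / 2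
    · linear_combination -w * n2 - v * (n3 - n1 - n2) / 2
  rw [hL, hcomm, Matrix.mul_assoc, hP.mul_transpose, Matrix.mul_one]

/-- Every linear preserver of the Lorentz spectrum is conjugation by an orthogonal matrix that preserves
the cone. -/
theorem exists_isAxialIsometry_map_eq (hφ : IsLorentzSpectrumPreserver (m := 2) φ) :
    ∃ P, IsAxialIsometry P ∧ ∀ A, φ A = P * A * Pᵀ := by
  obtain ⟨P, hP, harrow⟩ := exists_isAxialIsometry_map_arrow hφ
  let ψ : Matrix (Fin 3) (Fin 3) ℝ →ₗ[ℝ] Matrix (Fin 3) (Fin 3) ℝ :=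
    LinearMap.mulLeft ℝ Pᵀ ∘ₗ LinearMap.mulRight ℝ P ∘ₗ φ
  have hψφ : ∀ A, ψ A = Pᵀ * φ A * P := fun A => by simp [ψ, Matrix.mul_assoc]
  have hψ : IsLorentzSpectrumPreserver (m := 2) ψ := fun A => by
    have := (hP.transpose.spectra_eq (φ A)).1
    rw [Matrix.transpose_transpose, ← hψφ] at this
    exact (hφ A).trans this
  have hcancel : ∀ A, Pᵀ * (P * A * Pᵀ) * P = A := fun A => by
    rw [← Matrix.mul_assoc, ← Matrix.mul_assoc, hP.transpose_mul, Matrix.one_mul,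
      Matrix.mul_assoc, hP.transpose_mul, Matrix.mul_one]
  have hid : ∀ a v w d, ψ (arrow a v w d) = arrow a v w d := fun a v w d => by
    rw [hψφ, harrow, hcancel]
  refine ⟨P, hP, fun A => ?_⟩
  have h := map_eq_self hψ hid A
  rw [hψφ] at h
  conv_rhs => rw [← h]
  rw [← Matrix.mul_assoc, ← Matrix.mul_assoc, hP.mul_transpose, Matrix.one_mul,
    Matrix.mul_assoc, hP.mul_transpose, Matrix.mul_one]

end

theorem mainTheorem3
    (φ : Matrix (Fin 3) (Fin 3) ℝ →ₗ[ℝ] Matrix (Fin 3) (Fin 3) ℝ)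
    (hφ : IsLorentzSpectrumPreserver (m := 2) φ)
    (A : Matrix (Fin 3) (Fin 3) ℝ) :
    interiorLorentzSpectrum (m := 2) A = interiorLorentzSpectrum (m := 2) (φ A) ∧
      boundaryLorentzSpectrum (m := 2) A = boundaryLorentzSpectrum (m := 2) (φ A) := by
  obtain ⟨P, hP, h⟩ := exists_isAxialIsometry_map_eq hφ
  rw [h]
  exact (hP.spectra_eq A).2
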